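/- Let $H$ be a complex Hilbert space and $\mathrm{B}(H)$ the $C^*$-algebra of bounded linear operators on $H$. A linear functional $f:\mathrm{B}(H)\to\mathbb{C}$ is \emph{positive} if $f(A^*A)\ge 0$ for all $A\in\mathrm{B}(H)$; for positive functionals, $h\le f$ means that $f-h$ is positive. A functional $f$ is \emph{normal} if there is a trace class operator $T$ on $H$, its \emph{representing operator}, such that $f(A)=\operatorname{tr}(AT)$ for all $A\in\mathrm{B}(H)$. Let $f$ and $g$ be positive functionals on $\mathrm{B}(H)$. One calls $g$ \emph{$f$-closable} if for every sequence $(A_n)$ in $\mathrm{B}(H)$ the conditions $f(A_n^*A_n)\to 0$ and $g((A_n-A_m)^*(A_n-A_m))\to 0$ (as $n,m\to\infty$) imply $g(A_n^*A_n)\to 0$. One calls $g$ \emph{$f$-singular} if $h=0$ is the only positive functional $h$ on $\mathrm{B}(H)$ with $h\le f$ and $h\le g$. An \emph{$f$-Lebesgue decomposition} of $g$ is a pair $(g_0,g_1)$ of positive functionals on $\mathrm{B}(H)$ such that $g=g_0+g_1$, $g_0$ is $f$-closable and $g_1$ is $f$-singular. Theorem. Let $f$ be a normal positive functional on $\mathrm{B}(H)$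 with representing trace class operator $T$. (a) If $T$ has finite rank, then every normal positive functional $g$ on $\mathrm{B}(H)$ has exactly one $f$-Lebesgue decomposition. (b) If $T$ has infinite rank, then there is a normal positive functional $g$ on $\mathrm{B}(H)$ that has at least two different $f$-Lebesgue decompositions. -/

import Mathlib

open Filter Topology
open scoped ComplexOrder InnerProductSpace

universe u

namespace LebesgueDecomp

section StarAlgebra

variable {A : Type u} [Ring A] [StarRing A] [Algebra ℂ A]

/-- A linear functional `f` on a complex unital `*`-algebra is positive if `f (a* a) ≥ 0` for every
`a` (in the order of `ℂ`: the value is real and nonnegative). -/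
def IsPositiveFunctional (f : A →ₗ[ℂ] ℂ) : Prop :=
  ∀ a : A, 0 ≤ f (star a * a)

/-- The order between functionals: `h ≤ f` means that `f - h` is positive. -/
def FunctionalLE (h f : A →ₗ[ℂ] ℂ) : Prop :=
  IsPositiveFunctional (f - h)

/-- `g` is `f`-closable (strongly `f`-absolutely continuous): whenever `f (aₙ* aₙ) → 0` and
`g ((aₙ - aₘ)* (aₙ - aₘ)) → 0` as `n, m → ∞`, also `g (aₙ* aₙ) → 0`. -/
def IsClosable (f g : A →ₗ[ℂ] ℂ) : Prop :=
  ∀ a : ℕ → A,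
    Tendsto (fun n => f (star (a n) * a n)) atTop (𝓝 0) →
    Tendsto (fun p : ℕ × ℕ => g (star (a p.1 - a p.2) * (a p.1 - a p.2))) atTop (𝓝 0) →
    Tendsto (fun n => g (star (a n) * a n)) atTop (𝓝 0)

/-- `f` and `g` are mutually singular: the only positive functional below both is `0`. -/
def IsSingular (f g : A →ₗ[ℂ] ℂ) : Prop :=
  ∀ h : A →ₗ[ℂ] ℂ, IsPositiveFunctional h → FunctionalLE h f → FunctionalLE h g → h = 0

/-- The pair `p = (g₀, g₁)` is an `f`-Lebesgue decomposition of `g`: `g₀` and `g₁` are positive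
functionals with `g = g₀ + g₁`, where `g₀` is `f`-closable and `g₁` is `f`-singular. -/
structure IsLebesgueDecomposition (f g : A →ₗ[ℂ] ℂ) (p : (A →ₗ[ℂ] ℂ) × (A →ₗ[ℂ] ℂ)) : Prop where
  positive_fst : IsPositiveFunctional p.1
  positive_snd : IsPositiveFunctional p.2
  add_eq : g = p.1 + p.2
  closable : IsClosable f p.1
  singular : IsSingular f p.2

end StarAlgebra

section Hilbert

variable {H : Type u} [NormedAddCommGroup H] [InnerProductSpace ℂ H] [CompleteSpace H]

/-- `A` has trace `z`: over every orthonormal basis, the sum of the diagonal entries `⟨A e, e⟩`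
(with Mathlib's inner product, linear in the second variable) converges unconditionally to `z`. -/
def HasTrace (A : H →L[ℂ] H) (z : ℂ) : Prop :=
  ∀ (ι : Type u) (b : HilbertBasis ι ℂ H), HasSum (fun i => ⟪b i, A (b i)⟫_ℂ) z

/-- `T` is of trace class: the absolute value `|T| = (T* T)^(1/2)` has a finite trace. -/
def IsTraceClass (T : H →L[ℂ] H) : Prop :=
  ∃ z : ℂ, HasTrace (CFC.abs T) z

/-- `f` is the functional `f_T : A ↦ tr (A T)` given by the trace class operator `T`. -/
def IsRepresentedBy (f : (H →L[ℂ] H) →ₗ[ℂ] ℂ) (T : H →L[ℂ] H) : Prop :=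
  IsTraceClass T ∧ ∀ A : H →L[ℂ] H, HasTrace (A * T) (f A)

/-- A functional on `B(H)` is normal if it is represented by some trace class operator. -/
def IsNormalFunctional (f : (H →L[ℂ] H) →ₗ[ℂ] ℂ) : Prop :=
  ∃ T : H →L[ℂ] H, IsRepresentedBy f T

/-- The operator `T` has finite rank: its range is finite-dimensional. -/
def HasFiniteRank (T : H →L[ℂ] H) : Prop :=
  FiniteDimensional ℂ (LinearMap.range (T : H →ₗ[ℂ] H))

end Hilbert

end LebesgueDecomp

/-!
The link between `f` and the operator `T` is the Cauchy–Schwarz inequality for `f` at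
`A` and a rank one operator, which gives `‖A T u‖² ≤ ⟪u, T u⟫ f(A⋆ A)`
(`IsRepresentedBy.norm_apply_sq_le`). It replaces the spectral theorem for `T`.

Let `T` have finite rank, and let `P` be the projection onto its range. Summing the inequality over
an orthonormal basis of the range yields `‖A P‖² ≤ C f(A⋆ A)`. Hence a positive functional is
`f`-closable if and only if it vanishes on `A⋆ A` for all `A` in the left ideal `{A | A T = 0}`, if
and only if it is dominated by a multiple of `f`. Below a positive functional `g` there is a greatest
functional `g₀` with this property: the compression of `g`, in its GNS space, to the orthogonal
complement of the ideal (`exists_greatest_vanishing_on_ideal`). Maximality makes `g - g₀` singular.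
In any other decomposition `(p, q)`, the difference `g₀ - p` lies below `q` and below a multiple of
`f`, so it is zero by singularity of `q` (`existsUnique_isLebesgueDecomposition`).

Let `T` have infinite rank. Its range contains an orthonormal sequence `eₙ`, and since the diagonal
of `T` is summable it can be chosen with `|⟪eₙ, T eₙ⟫| < 64⁻ⁿ`. Put `k(A) = ∑ 4⁻ⁿ ⟪eₙ, A eₙ⟫` and
`ω(A) = ⟪ξ, A ξ⟫` with `ξ = ∑ 4⁻ⁿ eₙ`. As the `eₙ` are in the range of `T`, `f(Aₙ⋆ Aₙ) → 0` forces
`Aₙ eᵢ → 0` for each `i`, and `k` is `f`-closable (`isClosable_seqFunctional`). As `ω ≤ 4 k`, so is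
`k + ω`. But the functionals below `ω` are its multiples, and none except zero is below `f`, because
`|⟪eₙ, ξ⟫|² = 16⁻ⁿ`: so `ω` is `f`-singular. Therefore `(k + ω, 0)` and `(k, ω)` are both Lebesgue
decompositions of the normal functional `k + ω`.
-/

namespace LebesgueDecomp

/-! ### Positive functionals, domination and closability -/

section Elementary

variable {A : Type u} [Ring A] [StarRing A] [Algebra ℂ A]

lemma IsPositiveFunctional.re_nonneg {f : A →ₗ[ℂ] ℂ} (hf : IsPositiveFunctional f) (a : A) :
    0 ≤ (f (star a * a)).re :=
  (Complex.nonneg_iff.mp (hf a)).1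

lemma IsPositiveFunctional.ofReal_re {f : A →ₗ[ℂ] ℂ} (hf : IsPositiveFunctional f) (a : A) :
    ((f (star a * a)).re : ℂ) = f (star a * a) := by
  have h := (Complex.nonneg_iff.mp (hf a)).2
  apply Complex.ext <;> simp [← h]

lemma functionalLE_iff_re {f g : A →ₗ[ℂ] ℂ} (hf : IsPositiveFunctional f)
    (hg : IsPositiveFunctional g) :
    FunctionalLE f g ↔ ∀ a, (f (star a * a)).re ≤ (g (star a * a)).re := by
  refine forall_congr' fun a => ?_
  rw [LinearMap.sub_apply, sub_nonneg, ← hf.ofReal_re, ← hg.ofReal_re, Complex.real_le_real]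
  simp

lemma IsPositiveFunctional.norm_eq_re {f : A →ₗ[ℂ] ℂ} (hf : IsPositiveFunctional f) (a : A) :
    ‖f (star a * a)‖ = (f (star a * a)).re := by
  rw [← hf.ofReal_re a, Complex.norm_real, Real.norm_of_nonneg (hf.re_nonneg a), Complex.ofReal_re]

lemma IsPositiveFunctional.add {f g : A →ₗ[ℂ] ℂ} (hf : IsPositiveFunctional f)
    (hg : IsPositiveFunctional g) : IsPositiveFunctional (f + g) := fun a =>
  add_nonneg (hf a) (hg a)

lemma FunctionalLE.trans {f g h : A →ₗ[ℂ] ℂ} (h₁ : FunctionalLE f g) (h₂ : FunctionalLE g h) :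
    FunctionalLE f h := by
  have := IsPositiveFunctional.add h₂ h₁
  rwa [sub_add_sub_cancel] at this

lemma IsPositiveFunctional.tendsto_iff_re {f : A →ₗ[ℂ] ℂ} (hf : IsPositiveFunctional f)
    {β : Type*} {l : Filter β} (a : β → A) :
    Tendsto (fun i => f (star (a i) * a i)) l (𝓝 0) ↔
      Tendsto (fun i => (f (star (a i) * a i)).re) l (𝓝 0) := by
  rw [tendsto_zero_iff_norm_tendsto_zero]
  simp_rw [hf.norm_eq_re]

lemma isClosable_of_le_mul {f h : A →ₗ[ℂ] ℂ} (hf : IsPositiveFunctional f)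
    (hh : IsPositiveFunctional h) {D : ℝ}
    (hD : ∀ a, (h (star a * a)).re ≤ D * (f (star a * a)).re) : IsClosable f h := by
  intro a ha _
  rw [hf.tendsto_iff_re] at ha
  rw [hh.tendsto_iff_re]
  refine squeeze_zero (fun n => hh.re_nonneg _) (fun n => hD _) ?_
  simpa using ha.const_mul D

lemma IsClosable.eq_zero {f h : A →ₗ[ℂ] ℂ} (hc : IsClosable f h) {b : A}
    (hb : f (star b * b) = 0) : h (star b * b) = 0 := by
  have := hc (fun _ => b) (by simp [hb]) (by simp)
  exact tendsto_nhds_unique tendsto_const_nhds this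

lemma FunctionalLE.eq_zero {f h : A →ₗ[ℂ] ℂ} (hh : IsPositiveFunctional h)
    (hle : FunctionalLE h f) {b : A} (hb : f (star b * b) = 0) : h (star b * b) = 0 := by
  have := hle b
  rw [LinearMap.sub_apply, hb, zero_sub, neg_nonneg] at this
  exact le_antisymm this (hh b)

/-- A closable functional stays closable after adding a functional that it dominates up to a
constant: the sum defines an equivalent seminorm. -/
lemma IsClosable.add_of_le_mul {f k ω : A →ₗ[ℂ] ℂ} (hkc : IsClosable f k)
    (hk : IsPositiveFunctional k) (hω : IsPositiveFunctional ω) {C : ℝ}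
    (hC : ∀ a, (ω (star a * a)).re ≤ C * (k (star a * a)).re) : IsClosable f (k + ω) := by
  intro a ha hcauchy
  have hle : ∀ a, (k (star a * a)).re ≤ ((k + ω) (star a * a)).re := fun a => by
    rw [LinearMap.add_apply, Complex.add_re]
    exact le_add_of_nonneg_right (hω.re_nonneg a)
  have hk0 := hkc a ha <| (hk.tendsto_iff_re _).mpr <|
    squeeze_zero (fun _ => hk.re_nonneg _) (fun _ => hle _)
      (((hk.add hω).tendsto_iff_re _).mp hcauchy)
  have hω0 : Tendsto (fun n => ω (star (a n) * a n)) atTop (𝓝 0) := by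
    rw [hω.tendsto_iff_re]
    refine squeeze_zero (fun _ => hω.re_nonneg _) (fun _ => hC _) ?_
    simpa using ((hk.tendsto_iff_re _).mp hk0).const_mul C
  simpa using hk0.add hω0

end Elementary

/-! ### The greatest functional vanishing on a left ideal -/

section CStar

variable {A : Type u} [CStarAlgebra A] [PartialOrder A] [StarOrderedRing A]

/-- A positive functional on a C⋆-algebra as a bundled monotone map, which is the form in which
Mathlib provides the GNS construction. -/
noncomputable def IsPositiveFunctional.toPositiveLinearMap {f : A →ₗ[ℂ] ℂ}
    (hf : IsPositiveFunctional f) : A →ₚ[ℂ] ℂ :=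
  PositiveLinearMap.mk₀ f fun x hx => by
    obtain ⟨c, rfl⟩ := CStarAlgebra.nonneg_iff_eq_star_mul_self.mp hx
    exact hf c

/-- The Cauchy–Schwarz inequality for a positive functional. -/
lemma IsPositiveFunctional.cauchy_schwarz {f : A →ₗ[ℂ] ℂ} (hf : IsPositiveFunctional f)
    (a b : A) :
    ‖f (star a * b)‖ ^ 2 ≤ (f (star a * a)).re * (f (star b * b)).re := by
  set φ := hf.toPositiveLinearMap
  have h := norm_inner_le_norm (𝕜 := ℂ) (φ.toPreGNS a) (φ.toPreGNS b)
  have key : ∀ x : A, ‖φ.toPreGNS x‖ ^ 2 = (f (star x * x)).re := fun x => by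
    have := congrArg Complex.re (φ.preGNS_norm_sq (φ.toPreGNS x))
    rw [← Complex.ofReal_pow, Complex.ofReal_re] at this
    exact this
  rw [← key, ← key, ← mul_pow]
  exact pow_le_pow_left₀ (norm_nonneg _) h 2

lemma IsPositiveFunctional.eq_zero_of_star_mul_self {f : A →ₗ[ℂ] ℂ} (hf : IsPositiveFunctional f)
    {b : A} (hb : f (star b * b) = 0) (a : A) : f (star a * b) = 0 := by
  have h := hf.cauchy_schwarz a b
  rw [hb, Complex.zero_re, mul_zero] at h
  exact norm_eq_zero.mp (pow_eq_zero_iff two_ne_zero |>.mp (le_antisymm h (sq_nonneg _)))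

lemma IsPositiveFunctional.eq_zero_of_forall {f : A →ₗ[ℂ] ℂ} (hf : IsPositiveFunctional f)
    (h : ∀ a, f (star a * a) = 0) : f = 0 := by
  ext a
  simpa using hf.eq_zero_of_star_mul_self (h a) 1

/-- A positive functional that vanishes on the squares of `b` does not see a perturbation by `b`:
by Cauchy–Schwarz the mixed terms are zero. -/
lemma IsPositiveFunctional.apply_sub_of_eq_zero {f : A →ₗ[ℂ] ℂ} (hf : IsPositiveFunctional f)
    {b : A} (hb : f (star b * b) = 0) (a : A) :
    f (star (a - b) * (a - b)) = f (star a * a) := by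
  have h1 := hf.eq_zero_of_star_mul_self hb a
  have h2 : f (star b * a) = 0 := by
    have h := hf.cauchy_schwarz b a
    rw [hb, Complex.zero_re, zero_mul] at h
    exact norm_eq_zero.mp (pow_eq_zero_iff two_ne_zero |>.mp (le_antisymm h (sq_nonneg _)))
  rw [star_sub, sub_mul, mul_sub, mul_sub, map_sub, map_sub, map_sub, h1, h2, hb]
  ring

/-- Among the positive functionals below `g` that vanish on the squares of a left ideal `I` there is
a greatest one. In the GNS space of `g` the orthogonal complement of `I` reduces the left
multiplications, and the functional is the compression of `g` to it, so that its value at `a⋆ a` is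
the squared distance from `a` to `I`. -/
theorem exists_greatest_vanishing_on_ideal {g : A →ₗ[ℂ] ℂ} (hg : IsPositiveFunctional g)
    (I : Ideal A) :
    ∃ g₀ : A →ₗ[ℂ] ℂ, IsPositiveFunctional g₀ ∧ FunctionalLE g₀ g ∧
      (∀ b ∈ I, g₀ (star b * b) = 0) ∧
      ∀ h : A →ₗ[ℂ] ℂ, IsPositiveFunctional h → FunctionalLE h g →
        (∀ b ∈ I, h (star b * b) = 0) → FunctionalLE h g₀ := by
  set φ := hg.toPositiveLinearMap
  let ι : A → φ.GNS := fun a => ((φ.toPreGNS a : φ.PreGNS) : φ.GNS)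
  have hι_norm : ∀ a, ‖ι a‖ ^ 2 = (g (star a * a)).re := fun a => by
    have := congrArg Complex.re (φ.preGNS_norm_sq (φ.toPreGNS a))
    rw [← Complex.ofReal_pow, Complex.ofReal_re] at this
    rw [UniformSpace.Completion.norm_coe]
    exact this
  let π := φ.gnsStarAlgHom
  have hπ : ∀ a b, π a (ι b) = ι (a * b) := fun a b => φ.gnsNonUnitalStarAlgHom_apply_coe
  have hι_sub : ∀ a b, ι (a - b) = ι a - ι b := fun a b =>
    UniformSpace.Completion.coe_sub _ _
  let ιl : A →ₗ[ℂ] φ.GNS :=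
    (UniformSpace.Completion.toComplL (𝕜 := ℂ) (E := φ.PreGNS)).toLinearMap ∘ₗ
      φ.toPreGNS.toLinearMap
  let V : Submodule ℂ φ.GNS := ((I.restrictScalars ℂ).map ιl).topologicalClosure
  have hIV : ∀ b ∈ I, ι b ∈ V := fun b hb =>
    Submodule.le_topologicalClosure _ (Submodule.mem_map_of_mem (f := ιl) hb)
  have : CompleteSpace V := (Submodule.isClosed_topologicalClosure _).completeSpace_coe
  have hV_induct : ∀ S : Set φ.GNS, IsClosed S → (∀ b ∈ I, ι b ∈ S) → ∀ v ∈ V, v ∈ S := by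
    intro S hS hI v hv
    refine closure_minimal ?_ hS hv
    rintro _ ⟨b, hb, rfl⟩
    exact hI b hb
  have hπV : ∀ a, ∀ v ∈ V, π a v ∈ V := fun a =>
    hV_induct {v | π a v ∈ V} ((Submodule.isClosed_topologicalClosure _).preimage (π a).continuous)
      fun b hb => by
        change π a (ι b) ∈ V
        rw [hπ]
        exact hIV _ (I.mul_mem_left a hb)
  have hπ_inner : ∀ a x y, ⟪π (star a) x, y⟫_ℂ = ⟪x, π a y⟫_ℂ := fun a x y => by
    rw [map_star, ContinuousLinearMap.star_eq_adjoint, ContinuousLinearMap.adjoint_inner_left]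
  have hπVo : ∀ a, ∀ v ∈ Vᗮ, π a v ∈ Vᗮ := fun a v hv => by
    rw [Submodule.mem_orthogonal] at hv ⊢
    intro u hu
    rw [← hπ_inner]
    exact hv _ (hπV _ u hu)
  let Q : φ.GNS →L[ℂ] φ.GNS := Vᗮ.starProjection
  have hQ_mem : ∀ x, x - Q x ∈ V := fun x => by
    have := Submodule.sub_starProjection_mem_orthogonal (K := Vᗮ) x
    rwa [Submodule.orthogonal_orthogonal] at this
  have hQπ : ∀ a x, Q (π a x) = π a (Q x) := fun a x => by
    refine (Submodule.eq_starProjection_of_mem_of_inner_eq_zero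
      (hπVo a _ (Submodule.starProjection_apply_mem _ x)) fun w hw => ?_)
    rw [← map_sub]
    exact (Submodule.mem_orthogonal _ _).mp hw _ (hπV a _ (hQ_mem x))
  let η : φ.GNS := Q (ι 1)
  have hη : ∀ a, π a η = Q (ι a) := fun a => by
    rw [← hQπ, hπ, mul_one]
  let g₀ : A →ₗ[ℂ] ℂ :=
    { toFun := fun a => ⟪η, π a η⟫_ℂ
      map_add' := fun a b => by simp [inner_add_right]
      map_smul' := fun c a => by simp [inner_smul_right] }
  have hg₀ : ∀ a, g₀ (star a * a) = ((‖Q (ι a)‖ ^ 2 : ℝ) : ℂ) := fun a => by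
    change ⟪η, π (star a * a) η⟫_ℂ = _
    rw [map_mul, mul_apply_eq_comp, ← hπ_inner, star_star, hη,
      inner_self_eq_norm_sq_to_K]
    simp
  have hpos : IsPositiveFunctional g₀ := fun a => by
    rw [hg₀]; exact Complex.zero_le_real.mpr (sq_nonneg _)
  refine ⟨g₀, hpos, (functionalLE_iff_re hpos hg).mpr fun a => ?_, fun b hb => ?_,
    fun h hh hle hI => (functionalLE_iff_re hh hpos).mpr fun a => ?_⟩
  · rw [hg₀, Complex.ofReal_re, ← hι_norm]
    gcongr
    exact Submodule.norm_starProjection_apply_le _ _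
  · have : Q (ι b) = 0 := by
      rw [Submodule.starProjection_apply_eq_zero_iff, Submodule.orthogonal_orthogonal]
      exact hIV b hb
    rw [hg₀, this]; simp
  · rw [hg₀, Complex.ofReal_re]
    have := hV_induct {v | (h (star a * a)).re ≤ ‖ι a - v‖ ^ 2}
      (isClosed_le continuous_const (by fun_prop)) (fun b hb => by
        change _ ≤ ‖ι a - ι b‖ ^ 2
        rw [← hι_sub, hι_norm, ← hh.apply_sub_of_eq_zero (hI b hb) a]
        exact (functionalLE_iff_re hh hg).mp hle _) _ (hQ_mem (ι a))
    simpa using this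

lemma isSingular_zero (f : A →ₗ[ℂ] ℂ) : IsSingular f 0 := fun h hh _ h0 =>
  hh.eq_zero_of_forall fun a => le_antisymm (by simpa using h0 a) (hh a)

/-- If `f` vanishes on the squares of a left ideal `I` and dominates, up to a constant, every
positive functional that does so, then Lebesgue decompositions with respect to `f` exist and are
unique: the closable part has to be the greatest functional below `g` vanishing on `I`, since what
it would fall short of it is a functional below both the singular part and a multiple of `f`. -/
theorem existsUnique_isLebesgueDecomposition {f g : A →ₗ[ℂ] ℂ} (hf : IsPositiveFunctional f)
    (hg : IsPositiveFunctional g) (I : Ideal A) (hfI : ∀ b ∈ I, f (star b * b) = 0)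
    (hI : ∀ h : A →ₗ[ℂ] ℂ, IsPositiveFunctional h → (∀ b ∈ I, h (star b * b) = 0) →
      ∃ D : ℝ, 0 ≤ D ∧ ∀ a, (h (star a * a)).re ≤ D * (f (star a * a)).re) :
    ∃! p : (A →ₗ[ℂ] ℂ) × (A →ₗ[ℂ] ℂ), IsLebesgueDecomposition f g p := by
  obtain ⟨g₀, hg₀, hle, hg₀I, hmax⟩ := exists_greatest_vanishing_on_ideal hg I
  refine ⟨(g₀, g - g₀), ⟨hg₀, hle, by simp, ?_, ?_⟩, ?_⟩
  · obtain ⟨D, -, hD⟩ := hI g₀ hg₀ hg₀I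
    exact isClosable_of_le_mul hf hg₀ hD
  · intro h hh hhf hhg
    have hhI : ∀ b ∈ I, h (star b * b) = 0 := fun b hb => hhf.eq_zero hh (hfI b hb)
    have hsum : FunctionalLE (g₀ + h) g := by
      have : g - (g₀ + h) = g - g₀ - h := by abel
      rw [FunctionalLE, this]
      exact hhg
    have := hmax _ (hg₀.add hh) hsum fun b hb => by
      rw [LinearMap.add_apply, hg₀I b hb, hhI b hb, add_zero]
    refine hh.eq_zero_of_forall fun a => le_antisymm ?_ (hh a)
    simpa using this a
  · rintro ⟨p, q⟩ ⟨hp, hq, rfl, hpc, hqs⟩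
    dsimp only at hp hq hpc hqs
    have hpI : ∀ b ∈ I, p (star b * b) = 0 := fun b hb => hpc.eq_zero (hfI b hb)
    have hd : IsPositiveFunctional (g₀ - p) :=
      hmax p hp (by rw [FunctionalLE, add_sub_cancel_left]; exact hq) hpI
    have hdq : FunctionalLE (g₀ - p) q := by
      have : q - (g₀ - p) = p + q - g₀ := by abel
      rw [FunctionalLE, this]
      exact hle
    obtain ⟨D, hD0, hD⟩ := hI _ hd fun b hb => by
      rw [LinearMap.sub_apply, hg₀I b hb, hpI b hb, sub_zero]
    have hre : ∀ a, (((((D + 1)⁻¹ : ℝ) : ℂ) • (g₀ - p)) (star a * a)) =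
        (((D + 1)⁻¹ * ((g₀ - p) (star a * a)).re : ℝ) : ℂ) := fun a => by
      rw [LinearMap.smul_apply, smul_eq_mul, Complex.ofReal_mul, hd.ofReal_re]
    have hpos : IsPositiveFunctional ((((D + 1)⁻¹ : ℝ) : ℂ) • (g₀ - p)) := fun a => by
      rw [hre, Complex.zero_le_real]
      exact mul_nonneg (by positivity) (hd.re_nonneg a)
    have hzero := hqs _ hpos ((functionalLE_iff_re hpos hf).mpr fun a => by
        rw [hre, Complex.ofReal_re, inv_mul_le_iff₀ (by positivity)]
        nlinarith [hD a, hf.re_nonneg a])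
      (FunctionalLE.trans ((functionalLE_iff_re hpos hd).mpr fun a => by
        rw [hre, Complex.ofReal_re, inv_mul_le_iff₀ (by positivity)]
        nlinarith [hd.re_nonneg a]) hdq)
    have h0 : g₀ - p = 0 := by
      refine (smul_eq_zero.mp hzero).resolve_left ?_
      have : (D + 1)⁻¹ ≠ 0 := by positivity
      exact_mod_cast this
    have : p = g₀ := (sub_eq_zero.mp h0).symm
    subst this
    simp

end CStar

/-! ### Functionals represented by operators, and finite rank -/

section Trace

variable {H : Type u} [NormedAddCommGroup H] [InnerProductSpace ℂ H] [CompleteSpace H]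

lemma HasTrace.unique {A : H →L[ℂ] H} {z w : ℂ} (hz : HasTrace A z) (hw : HasTrace A w) :
    z = w := by
  obtain ⟨s, b, -⟩ := exists_hilbertBasis ℂ H
  exact (hz s b).unique (hw s b)

lemma hasTrace_rankOne_mul (x y : H) (T : H →L[ℂ] H) :
    HasTrace (InnerProductSpace.rankOne ℂ x y * T) ⟪y, T x⟫_ℂ := by
  intro ι b
  have h := b.hasSum_inner_mul_inner (ContinuousLinearMap.adjoint T y) x
  rw [ContinuousLinearMap.adjoint_inner_left] at h
  refine h.congr_fun fun i => ?_
  simp [ContinuousLinearMap.adjoint_inner_left]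

lemma IsRepresentedBy.apply_rankOne {f : (H →L[ℂ] H) →ₗ[ℂ] ℂ} {T : H →L[ℂ] H}
    (hT : IsRepresentedBy f T) (x y : H) :
    f (InnerProductSpace.rankOne ℂ x y) = ⟪y, T x⟫_ℂ :=
  (hT.2 _).unique (hasTrace_rankOne_mul x y T)

lemma star_rankOne_mul (v u : H) (A : H →L[ℂ] H) :
    star (InnerProductSpace.rankOne ℂ v u) * A =
      InnerProductSpace.rankOne ℂ u (ContinuousLinearMap.adjoint A v) := by
  ext x
  simp [ContinuousLinearMap.star_eq_adjoint, ContinuousLinearMap.adjoint_inner_left]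

lemma star_rankOne_mul_rankOne (v u : H) :
    star (InnerProductSpace.rankOne ℂ v u) * InnerProductSpace.rankOne ℂ v u =
      ((‖v‖ ^ 2 : ℝ) : ℂ) • InnerProductSpace.rankOne ℂ u u := by
  rw [star_rankOne_mul, InnerProductSpace.adjoint_rankOne, InnerProductSpace.rankOne_apply,
    inner_self_eq_norm_sq_to_K, map_smulₛₗ]
  simp

lemma IsRepresentedBy.apply_star_rankOne_mul_self {f : (H →L[ℂ] H) →ₗ[ℂ] ℂ} {T : H →L[ℂ] H}
    (hT : IsRepresentedBy f T) (v u : H) :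
    f (star (InnerProductSpace.rankOne ℂ v u) * InnerProductSpace.rankOne ℂ v u) =
      ((‖v‖ ^ 2 : ℝ) : ℂ) * ⟪u, T u⟫_ℂ := by
  rw [star_rankOne_mul_rankOne, map_smul, hT.apply_rankOne, smul_eq_mul]

lemma IsRepresentedBy.inner_re_nonneg {f : (H →L[ℂ] H) →ₗ[ℂ] ℂ} {T : H →L[ℂ] H}
    (hf : IsPositiveFunctional f) (hT : IsRepresentedBy f T) (u : H) : 0 ≤ (⟪u, T u⟫_ℂ).re := by
  rcases eq_or_ne u 0 with rfl | hu
  · simp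
  have := hf.re_nonneg (InnerProductSpace.rankOne ℂ u u)
  rw [hT.apply_star_rankOne_mul_self, Complex.re_ofReal_mul] at this
  exact nonneg_of_mul_nonneg_right this (by positivity)

/-- `f` controls the operators on the range of `T`: this is the Cauchy–Schwarz inequality for `f`
at `A` and the rank one operator `x ↦ ⟪u, x⟫ A T u`. -/
lemma IsRepresentedBy.norm_apply_sq_le {f : (H →L[ℂ] H) →ₗ[ℂ] ℂ} {T : H →L[ℂ] H}
    (hf : IsPositiveFunctional f) (hT : IsRepresentedBy f T) (A : H →L[ℂ] H) (u : H) :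
    ‖A (T u)‖ ^ 2 ≤ (⟪u, T u⟫_ℂ).re * (f (star A * A)).re := by
  rcases eq_or_ne (A (T u)) 0 with h0 | h0
  · rw [h0, norm_zero, zero_pow two_ne_zero]
    exact mul_nonneg (hT.inner_re_nonneg hf u) (hf.re_nonneg A)
  have h := hf.cauchy_schwarz (InnerProductSpace.rankOne ℂ (A (T u)) u) A
  rw [star_rankOne_mul, hT.apply_rankOne, ContinuousLinearMap.adjoint_inner_left,
    hT.apply_star_rankOne_mul_self, inner_self_eq_norm_sq_to_K, Complex.re_ofReal_mul] at h
  have hn : 0 < ‖A (T u)‖ ^ 2 := by positivity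
  simp only [norm_pow, RCLike.norm_ofReal, abs_norm] at h
  rw [sq, mul_assoc] at h
  exact le_of_mul_le_mul_left h hn

lemma IsRepresentedBy.eq_zero_of_mul_eq_zero {f : (H →L[ℂ] H) →ₗ[ℂ] ℂ} {T : H →L[ℂ] H}
    (hT : IsRepresentedBy f T) {A : H →L[ℂ] H} (hA : A * T = 0) : f (star A * A) = 0 := by
  refine (hT.2 _).unique fun ι b => ?_
  simp [mul_assoc, hA]

/-- On the range of a finite rank representing operator, `f` controls the operator norm. -/
lemma IsRepresentedBy.exists_norm_mul_starProjection_sq_le {f : (H →L[ℂ] H) →ₗ[ℂ] ℂ}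
    {T : H →L[ℂ] H} (hf : IsPositiveFunctional f) (hT : IsRepresentedBy f T)
    (K : Submodule ℂ H) [FiniteDimensional ℂ K] (hK : K ≤ LinearMap.range (T : H →ₗ[ℂ] H)) :
    ∃ C : ℝ, 0 ≤ C ∧ ∀ A : H →L[ℂ] H, ‖A * K.starProjection‖ ^ 2 ≤ C * (f (star A * A)).re := by
  let b := stdOrthonormalBasis ℂ K
  have hb : ∀ i, ∃ u, T u = b i := fun i => hK (b i).2
  choose u hu using hb
  refine ⟨(∑ i, √(⟪u i, T (u i)⟫_ℂ).re) ^ 2, sq_nonneg _, fun A => ?_⟩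
  have hA : A * K.starProjection =
      ∑ i, InnerProductSpace.rankOne ℂ (A (b i)) (b i : H) := by
    rw [b.starProjection_eq_sum_rankOne, Finset.mul_sum]
    exact Finset.sum_congr rfl fun i _ => InnerProductSpace.comp_rankOne _ _ _
  have hbd : ‖A * K.starProjection‖ ≤
      (∑ i, √(⟪u i, T (u i)⟫_ℂ).re) * √(f (star A * A)).re := by
    rw [hA, Finset.sum_mul]
    refine norm_sum_le_of_le _ fun i _ => ?_
    rw [InnerProductSpace.norm_rankOne, ← Submodule.coe_norm, b.norm_eq_one, mul_one,
      ← Real.sqrt_mul (hT.inner_re_nonneg hf _), ← hu]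
    exact Real.le_sqrt_of_sq_le (hT.norm_apply_sq_le hf A (u i))
  calc _ ≤ ((∑ i, √(⟪u i, T (u i)⟫_ℂ).re) * √(f (star A * A)).re) ^ 2 :=
        pow_le_pow_left₀ (norm_nonneg _) hbd 2
    _ = _ := by rw [mul_pow, Real.sq_sqrt (hf.re_nonneg A)]

/-- The left ideal of the operators that vanish on the range of `T`. -/
def leftAnnihilator (T : H →L[ℂ] H) : Ideal (H →L[ℂ] H) where
  carrier := {A | A * T = 0}
  add_mem' {A B} hA hB := by
    change (A + B) * T = 0
    change A * T = 0 at hA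
    change B * T = 0 at hB
    rw [add_mul, hA, hB, add_zero]
  zero_mem' := zero_mul T
  smul_mem' C A hA := by
    change (C • A) * T = 0
    change A * T = 0 at hA
    rw [smul_eq_mul, mul_assoc, hA, mul_zero]

theorem existsUnique_isLebesgueDecomposition_of_hasFiniteRank {f g : (H →L[ℂ] H) →ₗ[ℂ] ℂ}
    {T : H →L[ℂ] H} (hf : IsPositiveFunctional f) (hT : IsRepresentedBy f T)
    (hfin : HasFiniteRank T) (hg : IsPositiveFunctional g) :
    ∃! p : ((H →L[ℂ] H) →ₗ[ℂ] ℂ) × ((H →L[ℂ] H) →ₗ[ℂ] ℂ), IsLebesgueDecomposition f g p := by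
  refine existsUnique_isLebesgueDecomposition hf hg (leftAnnihilator T)
    (fun b hb => hT.eq_zero_of_mul_eq_zero hb) fun h hh hI => ?_
  have : FiniteDimensional ℂ (LinearMap.range (T : H →ₗ[ℂ] H)) := hfin
  set P := (LinearMap.range (T : H →ₗ[ℂ] H)).starProjection
  obtain ⟨C, hC, hCf⟩ := hT.exists_norm_mul_starProjection_sq_le hf _ le_rfl
  obtain ⟨D, hD⟩ := hh.toPositiveLinearMap.exists_norm_apply_le
  refine ⟨D * C, by positivity, fun a => ?_⟩
  have hPT : P * T = T := by
    ext x
    exact Submodule.starProjection_eq_self_iff.mpr (LinearMap.mem_range_self (T : H →ₗ[ℂ] H) x)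
  have hmem : a - a * P ∈ leftAnnihilator T := by
    change (a - a * P) * T = 0
    rw [sub_mul, mul_assoc, hPT, sub_self]
  rw [← hh.apply_sub_of_eq_zero (hI _ hmem) a, sub_sub_cancel, ← hh.norm_eq_re]
  calc _ ≤ D * ‖star (a * P) * (a * P)‖ := hD _
    _ = D * ‖a * P‖ ^ 2 := by rw [CStarRing.norm_star_mul_self, sq]
    _ ≤ D * (C * (f (star a * a)).re) := by gcongr; exact hCf a
    _ = _ := by ring

end Trace

/-! ### Normal functionals from square summable sequences of vectors -/

section Vectors

variable {H : Type u} [NormedAddCommGroup H] [InnerProductSpace ℂ H]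

/-- The functional `A ↦ ⟪ξ, A ξ⟫`. -/
noncomputable def vectorFunctional (ξ : H) : (H →L[ℂ] H) →ₗ[ℂ] ℂ where
  toFun A := ⟪ξ, A ξ⟫_ℂ
  map_add' A B := by simp
  map_smul' c A := by simp

lemma norm_vectorFunctional_le (ξ : H) (A : H →L[ℂ] H) :
    ‖vectorFunctional ξ A‖ ≤ ‖A‖ * ‖ξ‖ ^ 2 :=
  calc _ ≤ ‖ξ‖ * ‖A ξ‖ := norm_inner_le_norm _ _
    _ ≤ ‖ξ‖ * (‖A‖ * ‖ξ‖) := by gcongr; exact A.le_opNorm ξ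
    _ = _ := by ring

lemma summable_vectorFunctional {v : ℕ → H} (hv : Summable fun n => ‖v n‖ ^ 2) (A : H →L[ℂ] H) :
    Summable fun n => vectorFunctional (v n) A :=
  Summable.of_norm_bounded (hv.mul_left ‖A‖) fun _ => norm_vectorFunctional_le _ _

/-- The functional `A ↦ ∑ ⟪vₙ, A vₙ⟫` of a square summable sequence of vectors. -/
noncomputable def seqFunctional (v : ℕ → H) (hv : Summable fun n => ‖v n‖ ^ 2) :
    (H →L[ℂ] H) →ₗ[ℂ] ℂ where
  toFun A := ∑' n, vectorFunctional (v n) A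
  map_add' A B := by
    simp_rw [map_add]
    exact (summable_vectorFunctional hv A).tsum_add (summable_vectorFunctional hv B)
  map_smul' c A := by
    simp_rw [map_smul, smul_eq_mul, RingHom.id_apply]
    exact tsum_mul_left

lemma hasSum_seqFunctional {v : ℕ → H} (hv : Summable fun n => ‖v n‖ ^ 2) (A : H →L[ℂ] H) :
    HasSum (fun n => vectorFunctional (v n) A) (seqFunctional v hv A) :=
  (summable_vectorFunctional hv A).hasSum

/-- Interchanging the sums over the sequence and over the basis, which is allowed because
`∑ₙ ∑ᵢ |⟪vₙ, bᵢ⟫ ⟪bᵢ, A vₙ⟫|` is at most `∑ₙ (‖vₙ‖² + ‖A vₙ‖²) / 2`. -/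
lemma hasTrace_mul_of_hasSum_rankOne {v : ℕ → H} (hv : Summable fun n => ‖v n‖ ^ 2)
    {R : H →L[ℂ] H} (hR : HasSum (fun n => InnerProductSpace.rankOne ℂ (v n) (v n)) R)
    (A : H →L[ℂ] H) : HasTrace (A * R) (seqFunctional v hv A) := by
  intro ι b
  let F : ℕ × ι → ℂ := fun p => ⟪v p.1, b p.2⟫_ℂ * ⟪b p.2, A (v p.1)⟫_ℂ
  have hbound : ∀ p, ‖F p‖ ≤ (‖⟪b p.2, v p.1⟫_ℂ‖ ^ 2 + ‖⟪b p.2, A (v p.1)⟫_ℂ‖ ^ 2) / 2 := by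
    intro p
    rw [norm_mul, norm_inner_symm]
    nlinarith [sq_nonneg (‖⟪b p.2, v p.1⟫_ℂ‖ - ‖⟪b p.2, A (v p.1)⟫_ℂ‖)]
  have hsum : ∀ n, Summable fun i => (‖⟪b i, v n⟫_ℂ‖ ^ 2 + ‖⟪b i, A (v n)⟫_ℂ‖ ^ 2) / 2 := fun n =>
    ((b.orthonormal.inner_products_summable (v n)).add
      (b.orthonormal.inner_products_summable (A (v n)))).div_const 2
  have hF : Summable F := by
    refine Summable.of_norm_bounded (g := fun p : ℕ × ι =>
      (‖⟪b p.2, v p.1⟫_ℂ‖ ^ 2 + ‖⟪b p.2, A (v p.1)⟫_ℂ‖ ^ 2) / 2) ?_ hbound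
    refine (summable_prod_of_nonneg fun p => by positivity).mpr ⟨hsum, ?_⟩
    refine Summable.of_nonneg_of_le (fun n => tsum_nonneg fun i => by positivity) (fun n => ?_)
      (hv.mul_left ((1 + ‖A‖ ^ 2) / 2))
    rw [tsum_div_const, Summable.tsum_add (b.orthonormal.inner_products_summable (v n))
      (b.orthonormal.inner_products_summable (A (v n)))]
    have h1 := b.orthonormal.tsum_inner_products_le (v n)
    have h2 := b.orthonormal.tsum_inner_products_le (A (v n))
    have h3 : ‖A (v n)‖ ^ 2 ≤ ‖A‖ ^ 2 * ‖v n‖ ^ 2 := by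
      rw [← mul_pow]
      exact pow_le_pow_left₀ (norm_nonneg _) (A.le_opNorm _) 2
    linarith
  have hrow : HasSum (fun n => vectorFunctional (v n) A) (∑' p, F p) :=
    hF.hasSum.prod_fiberwise fun n => b.hasSum_inner_mul_inner (v n) (A (v n))
  rw [(hasSum_seqFunctional hv A).unique hrow]
  refine ((Equiv.prodComm ι ℕ).hasSum_iff.mpr hF.hasSum).prod_fiberwise fun i => ?_
  have h := ((hR.mapL (ContinuousLinearMap.apply ℂ H (b i))).mapL A).mapL (innerSL ℂ (b i))
  simpa [F, inner_smul_right] using h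

variable [CompleteSpace H]

lemma vectorFunctional_star_mul_self (ξ : H) (A : H →L[ℂ] H) :
    vectorFunctional ξ (star A * A) = ((‖A ξ‖ ^ 2 : ℝ) : ℂ) := by
  change ⟪ξ, (star A * A) ξ⟫_ℂ = _
  rw [mul_apply_eq_comp, ContinuousLinearMap.star_eq_adjoint,
    ContinuousLinearMap.adjoint_inner_right, inner_self_eq_norm_sq_to_K]
  simp

lemma isPositiveFunctional_vectorFunctional (ξ : H) : IsPositiveFunctional (vectorFunctional ξ) :=
  fun A => by
    rw [vectorFunctional_star_mul_self]
    exact Complex.zero_le_real.mpr (sq_nonneg _)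

lemma isPositiveFunctional_seqFunctional {v : ℕ → H} (hv : Summable fun n => ‖v n‖ ^ 2) :
    IsPositiveFunctional (seqFunctional v hv) := fun A =>
  tsum_nonneg fun n => isPositiveFunctional_vectorFunctional (v n) A

lemma hasSum_seqFunctional_star_mul_self {v : ℕ → H} (hv : Summable fun n => ‖v n‖ ^ 2)
    (A : H →L[ℂ] H) :
    HasSum (fun n => ‖A (v n)‖ ^ 2) (seqFunctional v hv (star A * A)).re := by
  have h := Complex.hasSum_re (hasSum_seqFunctional hv (star A * A))
  simpa only [vectorFunctional_star_mul_self, Complex.ofReal_re] using h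

lemma isNormalFunctional_seqFunctional {v : ℕ → H} (hv : Summable fun n => ‖v n‖ ^ 2) :
    IsNormalFunctional (seqFunctional v hv) := by
  have hs : Summable fun n => InnerProductSpace.rankOne ℂ (v n) (v n) :=
    Summable.of_norm (by simpa only [InnerProductSpace.norm_rankOne, ← sq] using hv)
  obtain ⟨R, hR⟩ := hs
  have hpos : 0 ≤ R := hR.nonneg fun n =>
    (ContinuousLinearMap.nonneg_iff_isPositive _).mpr (InnerProductSpace.isPositive_rankOne_self _)
  refine ⟨R, ⟨seqFunctional v hv 1, ?_⟩, hasTrace_mul_of_hasSum_rankOne hv hR⟩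
  rw [CFC.abs_of_nonneg R hpos]
  simpa using hasTrace_mul_of_hasSum_rankOne hv hR 1

lemma isNormalFunctional_seqFunctional_add_vectorFunctional {w : ℕ → H}
    (hw : Summable fun n => ‖w n‖ ^ 2) (ξ : H) :
    IsNormalFunctional (seqFunctional w hw + vectorFunctional ξ) := by
  obtain ⟨v, hv0, hvs⟩ : ∃ v : ℕ → H, v 0 = ξ ∧ ∀ n, v (n + 1) = w n :=
    ⟨fun n => Nat.casesOn n ξ w, rfl, fun _ => rfl⟩
  have hv : Summable fun n => ‖v n‖ ^ 2 :=
    (summable_nat_add_iff 1).mp (by simpa only [hvs] using hw)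
  have heq : seqFunctional w hw + vectorFunctional ξ = seqFunctional v hv := by
    ext A
    have h := (summable_vectorFunctional hv A).tsum_eq_zero_add
    simp only [hv0, hvs] at h
    rw [LinearMap.add_apply, add_comm]
    exact h.symm
  rw [heq]
  exact isNormalFunctional_seqFunctional hv

/-- A positive functional below `A ↦ ⟪ξ, A ξ⟫` is a multiple of it: it cannot distinguish `A` from
the restriction of `A` to the line spanned by `ξ`. -/
lemma exists_eq_mul_of_le_vectorFunctional {ξ : H} {h : (H →L[ℂ] H) →ₗ[ℂ] ℂ}
    (hh : IsPositiveFunctional h) (hle : FunctionalLE h (vectorFunctional ξ)) :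
    ∃ c : ℝ, ∀ A, (h (star A * A)).re = c * ‖A ξ‖ ^ 2 := by
  rcases eq_or_ne ξ 0 with rfl | hξ
  · refine ⟨0, fun A => ?_⟩
    rw [hle.eq_zero hh (by simp [vectorFunctional_star_mul_self])]
    simp
  have hN : ((‖ξ‖ ^ 2 : ℝ) : ℂ) ≠ 0 := by
    exact_mod_cast pow_ne_zero 2 (norm_ne_zero_iff.mpr hξ)
  set ζ : H := (((‖ξ‖ ^ 2 : ℝ) : ℂ)⁻¹) • ξ
  have hζ : ⟪ζ, ξ⟫_ℂ = 1 := by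
    rw [inner_smul_left, inner_self_eq_norm_sq_to_K, map_inv₀, Complex.conj_ofReal]
    simpa using inv_mul_cancel₀ hN
  refine ⟨(h (InnerProductSpace.rankOne ℂ ζ ζ)).re, fun A => ?_⟩
  have hz : h (star (A - InnerProductSpace.rankOne ℂ (A ξ) ζ) *
      (A - InnerProductSpace.rankOne ℂ (A ξ) ζ)) = 0 :=
    hle.eq_zero hh (by rw [vectorFunctional_star_mul_self]; simp [hζ])
  rw [← hh.apply_sub_of_eq_zero hz A, sub_sub_cancel, star_rankOne_mul_rankOne, map_smul,
    smul_eq_mul, Complex.re_ofReal_mul, mul_comm]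

end Vectors

/-! ### Infinite rank -/

section InfiniteRank

variable {H : Type u} [NormedAddCommGroup H] [InnerProductSpace ℂ H] [CompleteSpace H]

/-- If `f(Aₙ⋆ Aₙ) → 0` forces `Aₙ w → 0` for each vector `w` of the sequence, then the functional
of the sequence is closable: its Cauchy condition makes the convergence uniform. -/
lemma isClosable_seqFunctional {f : (H →L[ℂ] H) →ₗ[ℂ] ℂ} {w : ℕ → H}
    (hw : Summable fun n => ‖w n‖ ^ 2)
    (hfw : ∀ (a : ℕ → H →L[ℂ] H), Tendsto (fun n => f (star (a n) * a n)) atTop (𝓝 0) →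
      ∀ i, Tendsto (fun n => a n (w i)) atTop (𝓝 0)) :
    IsClosable f (seqFunctional w hw) := by
  intro a ha hcauchy
  have hk := isPositiveFunctional_seqFunctional hw
  rw [hk.tendsto_iff_re] at hcauchy ⊢
  rw [Metric.tendsto_nhds] at hcauchy
  rw [Metric.tendsto_atTop]
  intro ε hε
  obtain ⟨N, hN⟩ := eventually_atTop_prod_self'.mp (hcauchy (ε / 2) (half_pos hε))
  refine ⟨N, fun n hn => ?_⟩
  rw [Real.dist_0_eq_abs, abs_of_nonneg (hk.re_nonneg _)]
  refine lt_of_le_of_lt ?_ (half_lt_self hε)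
  -- Finite partial sums of `k((aₙ - aₘ)⋆ (aₙ - aₘ))` are bounded uniformly; let `m → ∞`.
  refine hasSum_le_of_sum_le (hasSum_seqFunctional_star_mul_self hw (a n)) fun s => ?_
  have hlim : Tendsto (fun m => ∑ i ∈ s, ‖(a n - a m) (w i)‖ ^ 2) atTop
      (𝓝 (∑ i ∈ s, ‖a n (w i)‖ ^ 2)) := by
    refine tendsto_finsetSum _ fun i _ => ?_
    simpa using ((tendsto_const_nhds (x := a n (w i))).sub (hfw a ha i)).norm.pow 2
  refine le_of_tendsto hlim (eventually_atTop.mpr ⟨N, fun m hm => ?_⟩)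
  have h := hN n hn m hm
  rw [Real.dist_0_eq_abs, abs_of_nonneg (hk.re_nonneg _)] at h
  exact (sum_le_hasSum s (fun i _ => sq_nonneg _)
    (hasSum_seqFunctional_star_mul_self hw (a n - a m))).trans h.le

/-- An infinite-dimensional space contains an orthonormal sequence. -/
lemma exists_orthonormal_nat (E : Type*) [NormedAddCommGroup E] [InnerProductSpace ℂ E]
    (hE : ¬ FiniteDimensional ℂ E) : ∃ e : ℕ → E, Orthonormal ℂ e := by
  let β := Module.Basis.ofVectorSpace ℂ E
  have : Infinite (Module.Basis.ofVectorSpaceIndex ℂ E) := by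
    by_contra hfin
    rw [not_infinite_iff_finite] at hfin
    exact hE (Module.Finite.of_basis β)
  have hx : LinearIndependent ℂ (β ∘ Infinite.natEmbedding _) :=
    β.linearIndependent.comp _ (Infinite.natEmbedding _).injective
  exact ⟨_, InnerProductSpace.gramSchmidtNormed_orthonormal hx⟩

/-- An infinite-dimensional range contains an orthonormal sequence, and since the trace of `T` over
an orthonormal basis extending it converges, a subsequence has diagonal entries as small as
prescribed. -/
lemma IsRepresentedBy.exists_orthonormal_norm_inner_lt {f : (H →L[ℂ] H) →ₗ[ℂ] ℂ}
    {T : H →L[ℂ] H} (hT : IsRepresentedBy f T) (hinf : ¬ HasFiniteRank T) {δ : ℕ → ℝ}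
    (hδ : ∀ n, 0 < δ n) :
    ∃ e : ℕ → H, Orthonormal ℂ e ∧ (∀ n, ∃ u, T u = e n) ∧ ∀ n, ‖⟪e n, T (e n)⟫_ℂ‖ < δ n := by
  obtain ⟨x, hx⟩ := exists_orthonormal_nat (LinearMap.range (T : H →ₗ[ℂ] H)) hinf
  have he : Orthonormal ℂ fun n => (x n : H) :=
    hx.comp_linearIsometry (LinearMap.range (T : H →ₗ[ℂ] H)).subtypeₗᵢ
  set e : ℕ → H := fun n => (x n : H)
  obtain ⟨w, b, hw, hb⟩ := he.toSubtypeRange.exists_hilbertBasis_extension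
  have hsum : Summable fun i : w => ⟪b i, (1 * T) (b i)⟫_ℂ := (hT.2 1 w b).summable
  let j : ℕ → w := fun n => ⟨e n, hw ⟨n, rfl⟩⟩
  have hj : Function.Injective j := fun m n h =>
    he.linearIndependent.injective (congrArg Subtype.val h :)
  have hlim : Tendsto (fun n => ‖⟪e n, T (e n)⟫_ℂ‖) atTop (𝓝 0) := by
    have := (hsum.comp_injective hj).tendsto_atTop_zero.norm
    simpa [Function.comp_def, hb, j] using this
  obtain ⟨φ, hφ, hlt⟩ := extraction_forall_of_eventually
    (P := fun n m => ‖⟪e m, T (e m)⟫_ℂ‖ < δ n) fun n => hlim.eventually_lt_const (hδ n)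
  exact ⟨e ∘ φ, he.comp _ hφ.injective, fun n => (x (φ n)).2, hlt⟩

/-- If `ξ` has coefficients along `eₙ` that are not controlled by `⟪eₙ, T eₙ⟫`, no nonzero multiple
of the functional of `ξ` lies below `f`. -/
lemma IsRepresentedBy.isSingular_vectorFunctional {f : (H →L[ℂ] H) →ₗ[ℂ] ℂ} {T : H →L[ℂ] H}
    (hf : IsPositiveFunctional f) (hT : IsRepresentedBy f T) {ξ : H} {e : ℕ → H}
    (he : ∀ n, ‖⟪e n, T (e n)⟫_ℂ‖ < (64 ^ n : ℝ)⁻¹) (hξ : ∀ n, ⟪e n, ξ⟫_ℂ = (4 ^ n : ℂ)⁻¹) :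
    IsSingular f (vectorFunctional ξ) := by
  intro h hh hhf hhξ
  obtain ⟨c, hc⟩ := exists_eq_mul_of_le_vectorFunctional hh hhξ
  have hξ0 : 0 < ‖ξ‖ := norm_pos_iff.mpr fun h0 => by simpa [h0] using hξ 0
  have hbound : ∀ n : ℕ, c ≤ (4⁻¹ : ℝ) ^ n := fun n => by
    have h1 := (functionalLE_iff_re hh hf).mp hhf (InnerProductSpace.rankOne ℂ ξ (e n))
    rw [hc, hT.apply_star_rankOne_mul_self, Complex.re_ofReal_mul,
      InnerProductSpace.rankOne_apply, hξ, norm_smul, mul_pow, ← mul_assoc, mul_comm] at h1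
    have h2 := le_of_mul_le_mul_left h1 (by positivity)
    have h3 := h2.trans ((Complex.re_le_norm _).trans (he n).le)
    have h4 : ‖((4 ^ n : ℂ)⁻¹)‖ ^ 2 = ((16 : ℝ) ^ n)⁻¹ := by
      rw [norm_inv, norm_pow, inv_pow, ← pow_mul, mul_comm, pow_mul]
      norm_num
    rw [h4, ← div_eq_mul_inv, div_le_iff₀ (by positivity)] at h3
    refine h3.trans (le_of_eq ?_)
    rw [← inv_pow, ← mul_pow]
    norm_num
  have hc0 : c ≤ 0 := ge_of_tendsto' (tendsto_pow_atTop_nhds_zero_of_lt_one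
    (by norm_num : (0 : ℝ) ≤ 4⁻¹) (by norm_num)) hbound
  refine hh.eq_zero_of_forall fun A => ?_
  have hre : (h (star A * A)).re = 0 := le_antisymm
    (by rw [hc]; exact mul_nonpos_of_nonpos_of_nonneg hc0 (sq_nonneg _)) (hh.re_nonneg A)
  rw [← hh.ofReal_re, hre, Complex.ofReal_zero]

theorem exists_two_isLebesgueDecomposition_of_not_hasFiniteRank {f : (H →L[ℂ] H) →ₗ[ℂ] ℂ}
    {T : H →L[ℂ] H} (hf : IsPositiveFunctional f) (hT : IsRepresentedBy f T)
    (hinf : ¬ HasFiniteRank T) :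
    ∃ g : (H →L[ℂ] H) →ₗ[ℂ] ℂ, IsPositiveFunctional g ∧ IsNormalFunctional g ∧
      ∃ p q : ((H →L[ℂ] H) →ₗ[ℂ] ℂ) × ((H →L[ℂ] H) →ₗ[ℂ] ℂ),
        IsLebesgueDecomposition f g p ∧ IsLebesgueDecomposition f g q ∧ p ≠ q := by
  obtain ⟨e, he, heT, hlt⟩ := hT.exists_orthonormal_norm_inner_lt hinf
    (δ := fun n => (64 ^ n : ℝ)⁻¹) fun n => by positivity
  have hgeo : Summable fun n : ℕ => (2⁻¹ : ℝ) ^ n := summable_geometric_of_lt_one (by norm_num)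
    (by norm_num)
  -- `k = ∑ 4⁻ⁿ ⟪eₙ, · eₙ⟫` dominates a multiple of `ω`, as `∑ 2⁻ⁿ wₙ` converges to `ξ`, whereas the
  -- squared coefficients `16⁻ⁿ` of `ξ` outgrow the bounds `64⁻ⁿ` on the diagonal entries of `T`.
  let w : ℕ → H := fun n => ((2⁻¹ : ℂ) ^ n) • e n
  have hw_norm : ∀ n, ‖w n‖ = (2⁻¹ : ℝ) ^ n := fun n => by
    rw [norm_smul, he.1 n, norm_pow, norm_inv]
    norm_num
  have hw : Summable fun n => ‖w n‖ ^ 2 := by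
    simp_rw [hw_norm, ← pow_mul, mul_comm _ 2, pow_mul]
    exact summable_geometric_of_lt_one (by norm_num) (by norm_num)
  have hξs : Summable fun n => ((2⁻¹ : ℂ) ^ n) • w n := by
    refine Summable.of_norm_bounded hgeo fun n => ?_
    rw [norm_smul, hw_norm, norm_pow, norm_inv, Complex.norm_ofNat]
    exact mul_le_of_le_one_right (by positivity) (pow_le_one₀ (by norm_num) (by norm_num))
  obtain ⟨ξ, hξ⟩ := hξs
  have hcoef : ∀ n, ⟪e n, ξ⟫_ℂ = (4 ^ n : ℂ)⁻¹ := fun n => by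
    have h := hξ.mapL (innerSL ℂ (e n))
    refine h.unique ?_
    convert hasSum_single n fun m hm => ?_ using 1
    · simp only [w, innerSL_apply_apply, inner_smul_right, inner_self_eq_norm_sq_to_K, he.1 n]
      rw [← mul_assoc, ← mul_pow, ← inv_pow]
      norm_num
    · simp [w, he.2 hm.symm]
  set k := seqFunctional w hw
  set ω := vectorFunctional ξ
  have hk : IsPositiveFunctional k := isPositiveFunctional_seqFunctional hw
  have hω : IsPositiveFunctional ω := isPositiveFunctional_vectorFunctional ξ
  have hkc : IsClosable f k := by
    refine isClosable_seqFunctional hw fun a ha i => ?_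
    obtain ⟨u, hu⟩ := heT i
    rw [hf.tendsto_iff_re] at ha
    have h0 : Tendsto (fun n => a n (e i)) atTop (𝓝 0) := by
      rw [tendsto_zero_iff_norm_tendsto_zero, ← hu]
      refine squeeze_zero (fun _ => norm_nonneg _)
        (fun n => Real.le_sqrt_of_sq_le (hT.norm_apply_sq_le hf (a n) u)) ?_
      simpa using (ha.const_mul (⟪u, T u⟫_ℂ).re).sqrt
    simpa [w] using h0.const_smul ((2⁻¹ : ℂ) ^ i)
  have hωk : ∀ A, (ω (star A * A)).re ≤ 4 * (k (star A * A)).re := fun A => by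
    have hAw : ∀ n, ‖A (w n)‖ ≤ √(k (star A * A)).re := fun n =>
      Real.le_sqrt_of_sq_le
        (le_hasSum (hasSum_seqFunctional_star_mul_self hw A) n fun _ _ => sq_nonneg _)
    have hAξ : ‖A ξ‖ ≤ 2 * √(k (star A * A)).re := by
      have hg : HasSum (fun n : ℕ => (2⁻¹ : ℝ) ^ n * √(k (star A * A)).re)
          (2 * √(k (star A * A)).re) := by
        have := hasSum_geometric_of_lt_one (r := (2⁻¹ : ℝ)) (by norm_num) (by norm_num)
        norm_num at this
        simpa using this.mul_right √(k (star A * A)).re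
      rw [← (hξ.mapL A).tsum_eq]
      refine tsum_of_norm_bounded hg fun n => ?_
      rw [map_smul, norm_smul, norm_pow, norm_inv, Complex.norm_ofNat]
      gcongr
      exact hAw n
    rw [vectorFunctional_star_mul_self, Complex.ofReal_re]
    calc _ ≤ (2 * √(k (star A * A)).re) ^ 2 := pow_le_pow_left₀ (norm_nonneg _) hAξ 2
      _ = _ := by rw [mul_pow, Real.sq_sqrt (hk.re_nonneg A)]; norm_num
  have hωs : IsSingular f ω := hT.isSingular_vectorFunctional hf hlt hcoef
  have hsumc : IsClosable f (k + ω) := hkc.add_of_le_mul hk hω hωk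
  have hω0 : ω ≠ 0 := fun h0 => by
    have h1 : ω 1 = 0 := by rw [h0, LinearMap.zero_apply]
    have hξ0 : ξ = 0 := inner_self_eq_zero (𝕜 := ℂ).mp h1
    simpa [hξ0] using hcoef 0
  refine ⟨k + ω, hk.add hω, isNormalFunctional_seqFunctional_add_vectorFunctional hw ξ,
    (k + ω, 0), (k, ω),
    ⟨hk.add hω, fun a => by simp, (add_zero _).symm, hsumc, isSingular_zero f⟩,
    ⟨hk, hω, rfl, hkc, hωs⟩,
    fun h => hω0 (congrArg Prod.snd h).symm⟩

end InfiniteRank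

end LebesgueDecomp

theorem theoremT {H : Type u} [NormedAddCommGroup H] [InnerProductSpace ℂ H] [CompleteSpace H]
    (f : (H →L[ℂ] H) →ₗ[ℂ] ℂ) (T : H →L[ℂ] H)
    (hf : LebesgueDecomp.IsPositiveFunctional f) (hT : LebesgueDecomp.IsRepresentedBy f T) :
    (LebesgueDecomp.HasFiniteRank T →
      ∀ g : (H →L[ℂ] H) →ₗ[ℂ] ℂ,
        LebesgueDecomp.IsPositiveFunctional g → LebesgueDecomp.IsNormalFunctional g →
          ∃! p : ((H →L[ℂ] H) →ₗ[ℂ] ℂ) × ((H →L[ℂ] H) →ₗ[ℂ] ℂ),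
            LebesgueDecomp.IsLebesgueDecomposition f g p) ∧
    (¬ LebesgueDecomp.HasFiniteRank T →
      ∃ g : (H →L[ℂ] H) →ₗ[ℂ] ℂ,
        LebesgueDecomp.IsPositiveFunctional g ∧ LebesgueDecomp.IsNormalFunctional g ∧
          ∃ p q : ((H →L[ℂ] H) →ₗ[ℂ] ℂ) × ((H →L[ℂ] H) →ₗ[ℂ] ℂ),
            LebesgueDecomp.IsLebesgueDecomposition f g p ∧
            LebesgueDecomp.IsLebesgueDecomposition f g q ∧ p ≠ q) :=
  ⟨fun hfin _ hg _ =>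
      LebesgueDecomp.existsUnique_isLebesgueDecomposition_of_hasFiniteRank hf hT hfin hg,
    fun hinf =>
      LebesgueDecomp.exists_two_isLebesgueDecomposition_of_not_hasFiniteRank hf hT hinf⟩
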